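/- Conventions. A $C^*$-probability space $(\mathcal A,\varphi)$ is a (not necessarily unital) $C^*$-algebra $\mathcal A$ with a state $\varphi$, i.e. a positive linear functional of norm one; let $(\mathcal H,\sigma,\xi)$ be its GNS triple, so $\varphi(a)=\langle\sigma(a)\xi,\xi\rangle$. For a nonempty totally ordered set $I$ let $I_n$ be the set of $(i_1,\dots,i_n)\in I^n$ such that $i_1>\dots>i_m<\dots<i_n$ for some $1\le m\le n$. Given $C^*$-probability spaces $(\mathcal A_i,\varphi_i)_{i\in I}$ with GNS triples $(\mathcal H_i,\sigma_i,\xi_i)$, let $\mathcal F=\mathbb C\xi\oplus\bigoplus_{n\ge1}\bigoplus_{i_1\ne\dots\ne i_n}\mathring{\mathcal H}_{i_1}\otimes\dots\otimes\mathring{\mathcal H}_{i_n}$, $\mathring{\mathcal H}_i=\mathcal H_i\ominus\mathbb C\xi_i$, be the free product of the Hilbert spaces with vacuum vector $\xi$, let $\lambda_i$ be the left representation of $B(\mathcal H_i)$ on $\mathcal F$, and let $U_i$ be the orthogonal projection of $\mathcal F$ onto the closed span of $\xi$ and of the summands with $(i_1,\dots,i_n)\in I_n$ such that $i_1=i$ or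 $(i,i_1,\dots,i_n)\in I_{n+1}$. Put $\widetilde\lambda_i(T)=U_i\lambda_i(T)U_i$. The V-monotone product of the states $\varphi_i$ is the state $\phi$ on the free product $\bigsqcup_{i\in I}\mathcal A_i$ of $C^*$-algebras without identification of units (the coproduct of the $\mathcal A_i$ in the category of $C^*$-algebras and $*$-homomorphisms, units not required or preserved) determined by $$\phi(a_1\cdots a_n)=\big\langle \widetilde\lambda_{i_1}(\sigma_{i_1}(a_1))\cdots\widetilde\lambda_{i_n}(\sigma_{i_n}(a_n))\,\xi,\xi\big\rangle ,\qquad a_k\in\mathcal A_{i_k}.$$ For $I=\{1<2\}$ it is written $\varphi_1\veebar \varphi_2$, a state on $\mathcal A_1\sqcup\mathcal A_2$. Proposition. The V-monotone product of states is not associative. More precisely: (a) For all $C^*$-probability spaces $(\mathcal A_i,\varphi_i)$, $i=1,2,3$, and all $a_1,a_2\in\mathcal A_1$, $b\in\mathcal A_2$, $c_1,c_2\in\mathcal A_3$, $$\begin{aligned}((\varphi_1\veebar \varphi_2)\veebar \varphi_3)(a_1c_1bc_2a_2)={}&\varphi_1(a_1a_2)\varphi_2(b)\varphi_3(c_1)\varphi_3(c_2)+\varphi_1(a_1)\varphi_1(a_2)\varphi_2(b)\varphi_3(c_1c_2)\\&-\varphi_1(a_1)\varphi_1(a_2)\varphi_2(b)\varphi_3(c_1)\varphi_3(c_2),\end{aligned}$$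 $$(\varphi_1\veebar (\varphi_2\veebar \varphi_3))(a_1c_1bc_2a_2)=\varphi_1(a_1a_2)\varphi_2(b)\varphi_3(c_1c_2).$$ (b) There are $C^*$-probability spaces $(\mathcal A_i,\varphi_i)$, $i=1,2,3$, with unital $\mathcal A_i$, such that the two moments in (a) are different for some $a_1,a_2\in\mathcal A_1$, $b\in\mathcal A_2$, $c_1,c_2\in\mathcal A_3$; and, for these spaces, $(\varphi_1\veebar \varphi_2)\veebar \varphi_3$ and $\varphi_1\veebar (\varphi_2\veebar \varphi_3)$ do not correspond to each other under the canonical isomorphism $(\mathcal A_1\sqcup\mathcal A_2)\sqcup\mathcal A_3\cong\mathcal A_1\sqcup(\mathcal A_2\sqcup\mathcal A_3)$. -/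

import Mathlib

open scoped ENNReal ComplexOrder InnerProductSpace

universe u

namespace VMonotone

/-! ### Free products of C⋆-algebras without identification of units -/

/-- Transport of a C⋆-algebra structure along a bijection. -/
noncomputable abbrev transferCStar {α β : Type*} (e : α ≃ β) [NonUnitalCStarAlgebra β] :
    NonUnitalCStarAlgebra α := by
  letI r : NonUnitalRing α := e.nonUnitalRing
  letI m : Module ℂ α := e.module ℂ
  letI s : Star α := ⟨fun a => e.symm (star (e a))⟩
  let f : α →ₗ[ℂ] β :=
    { toFun := e
      map_add' := fun a b => e.apply_symm_apply _
      map_smul' := fun c a => e.apply_symm_apply _ }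
  let g : α →ₙ+* β :=
    { toFun := e
      map_add' := fun a b => e.apply_symm_apply _
      map_zero' := e.apply_symm_apply _
      map_mul' := fun a b => e.apply_symm_apply _ }
  have hs : ∀ a, g (star a) = star (g a) := fun a => e.apply_symm_apply _
  have hf : ∀ (c : ℂ) a, g (c • a) = c • g a := fun c a => e.apply_symm_apply _
  have hinj : Function.Injective g := e.injective
  letI n : NonUnitalNormedRing α := NonUnitalNormedRing.induced α β g hinj
  have hn : ∀ a : α, ‖a‖ = ‖g a‖ := fun _ => rfl
  letI sr : StarRing α :=
    { star_involutive := fun a => hinj (by simp [hs])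
      star_mul := fun a b => hinj (by simp [hs])
      star_add := fun a b => hinj (by simp [hs]) }
  have hiso : Isometry g := fun _ _ => rfl
  exact
    { toNonUnitalNormedRing := n
      toStarRing := sr
      toCompleteSpace := by
        have : IsUniformInducing (e : α → β) := hiso.isUniformInducing
        exact (this.completeSpace_congr e.surjective).2 inferInstance
      norm_mul_self_le := fun a => by
        rw [hn, hn, map_mul, hs, CStarRing.norm_star_mul_self]
      toModule := m
      norm_smul_le := fun c a => by
        rw [hn, hn, hf]; exact norm_smul_le _ _
      smul_assoc := fun c a b => hinj (by
        simp only [smul_eq_mul, map_mul, hf]; exact smul_mul_assoc _ _ _)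
      smul_comm := fun c a b => hinj (by
        simp only [smul_eq_mul, map_mul, hf]; exact (mul_smul_comm _ _ _).symm)
      star_smul := fun c a => hinj (by simp [hs, hf]) }


/-- A family of ⋆-homomorphisms from the `A i` to a common C⋆-algebra. -/
structure Cocone {ι : Type} (A : ι → Type u) [∀ i, NonUnitalCStarAlgebra (A i)] :
    Type (u + 1) where
  B : Type u
  [alg : NonUnitalCStarAlgebra B]
  hom : ∀ i, A i →⋆ₙₐ[ℂ] B

attribute [instance] Cocone.alg

section FreeProduct

variable {ι : Type} (A : ι → Type u) [∀ i, NonUnitalCStarAlgebra (A i)]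

/-- The direct product of the targets of all cocones. -/
abbrev CoconeProd : Type (u + 1) := lp (fun c : Cocone A => c.B) ∞

/-- The map from `A i` to the product of the targets of all cocones. -/
noncomputable def toCoconeProd (i : ι) : A i →⋆ₙₐ[ℂ] CoconeProd A where
  toFun a := ⟨fun c => c.hom i a, memℓp_infty
    ⟨‖a‖, by rintro _ ⟨c, rfl⟩; exact NonUnitalStarAlgHom.norm_apply_le (c.hom i) a⟩⟩
  map_smul' c a := by ext d; exact map_smul (d.hom i) c a
  map_zero' := by ext d; exact map_zero (d.hom i)
  map_add' a b := by ext d; exact map_add (d.hom i) a b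
  map_mul' a b := by ext d; exact map_mul (d.hom i) a b
  map_star' a := by ext d; exact map_star (d.hom i) a

/-- The C⋆-subalgebra generated by the images of the `A i`. -/
noncomputable def generated : NonUnitalStarSubalgebra ℂ (CoconeProd A) :=
  (NonUnitalStarAlgebra.adjoin ℂ (⋃ i, Set.range (toCoconeProd A i))).topologicalClosure

/-- Formal ⋆-polynomials in the elements of the `A i` (used only to bound cardinalities). -/
inductive Expr : Type u
  | gen (i : ι) (a : A i)
  | add (x y : Expr)
  | mul (x y : Expr)
  | smul (c : ℂ) (x : Expr)
  | star (x : Expr)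

/-- The value of a formal ⋆-polynomial. -/
noncomputable def Expr.eval : Expr A → CoconeProd A
  | .gen i a => toCoconeProd A i a
  | .add x y => x.eval + y.eval
  | .mul x y => x.eval * y.eval
  | .smul c x => c • x.eval
  | .star x => Star.star x.eval

theorem mem_range_eval {x : CoconeProd A}
    (hx : x ∈ NonUnitalStarAlgebra.adjoin ℂ (⋃ i, Set.range (toCoconeProd A i))) :
    x = 0 ∨ x ∈ Set.range (Expr.eval A) := by
  induction hx using NonUnitalStarAlgebra.adjoin_induction with
  | mem x hx =>
    obtain ⟨i, a, rfl⟩ := Set.mem_iUnion.1 hx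
    exact Or.inr ⟨.gen i a, rfl⟩
  | zero => exact Or.inl rfl
  | add x y _ _ hx hy =>
    rcases hx with rfl | ⟨p, rfl⟩
    · simpa using hy
    · rcases hy with rfl | ⟨q, rfl⟩
      · exact Or.inr ⟨p, by simp⟩
      · exact Or.inr ⟨.add p q, rfl⟩
  | mul x y _ _ hx hy =>
    rcases hx with rfl | ⟨p, rfl⟩
    · simp
    · rcases hy with rfl | ⟨q, rfl⟩
      · simp
      · exact Or.inr ⟨.mul p q, rfl⟩
  | smul c x _ hx =>
    rcases hx with rfl | ⟨p, rfl⟩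
    · simp
    · exact Or.inr ⟨.smul c p, rfl⟩
  | star x _ hx =>
    rcases hx with rfl | ⟨p, rfl⟩
    · simp
    · exact Or.inr ⟨.star p, rfl⟩

instance small_generated : Small.{u} (generated A) := by
  let ev : Option (Expr A) → CoconeProd A := fun o => o.elim 0 (Expr.eval A)
  have h : ∀ x : generated A, ∃ s : ℕ → Option (Expr A),
      Filter.Tendsto (fun n => ev (s n)) Filter.atTop (nhds (x : CoconeProd A)) := by
    rintro ⟨x, hx⟩
    obtain ⟨y, hy, hlim⟩ := mem_closure_iff_seq_limit.1 hx
    have : ∀ n, ∃ o, ev o = y n := fun n => by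
      rcases mem_range_eval A (hy n) with h | ⟨p, hp⟩
      · exact ⟨none, h.symm⟩
      · exact ⟨some p, hp⟩
    choose s hs using this
    exact ⟨s, by simpa [hs] using hlim⟩
  choose s hs using h
  refine small_of_injective (f := s) fun x y hxy => Subtype.ext ?_
  have h := hs x
  rw [hxy] at h
  exact tendsto_nhds_unique h (hs y)

instance isClosed_generated : IsClosed (generated A : Set (CoconeProd A)) :=
  NonUnitalStarSubalgebra.isClosed_topologicalClosure _

/-- The free product `⊔ᵢ A i` of C⋆-algebras, without identification of units: the coproduct of the
`A i` in the category of (not necessarily unital) C⋆-algebras and ⋆-homomorphisms. -/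
def FreeProduct : Type u := Shrink.{u} (generated A)

noncomputable instance : NonUnitalCStarAlgebra (FreeProduct A) :=
  transferCStar (equivShrink (generated A)).symm

namespace FreeProduct

/-- The identification of `FreeProduct A` with the algebra generated by the `A i`. -/
noncomputable def equivGenerated : FreeProduct A ≃⋆ₐ[ℂ] generated A where
  toEquiv := (equivShrink (generated A)).symm
  map_add' _ _ := Equiv.apply_symm_apply (equivShrink (generated A)).symm _
  map_mul' _ _ := Equiv.apply_symm_apply (equivShrink (generated A)).symm _
  map_smul' _ _ := Equiv.apply_symm_apply (equivShrink (generated A)).symm _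
  map_star' _ := Equiv.apply_symm_apply (equivShrink (generated A)).symm _

variable {A}

/-- The canonical embedding of `A i` into the free product. -/
noncomputable def of (i : ι) : A i →⋆ₙₐ[ℂ] FreeProduct A where
  toFun a := (equivGenerated A).symm ⟨toCoconeProd A i a, subset_closure
    (NonUnitalStarAlgebra.subset_adjoin ℂ _ (Set.mem_iUnion.2 ⟨i, a, rfl⟩))⟩
  map_smul' c a := by
    rw [MonoidHom.id_apply, ← map_smul]; congr 1; exact Subtype.ext (map_smul _ c a)
  map_zero' := by
    rw [← map_zero (equivGenerated A).symm]; congr 1; exact Subtype.ext (map_zero _)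
  map_add' a b := by rw [← map_add]; congr 1; exact Subtype.ext (map_add _ a b)
  map_mul' a b := by rw [← map_mul]; congr 1; exact Subtype.ext (map_mul _ a b)
  map_star' a := by rw [← map_star]; congr 1; exact Subtype.ext (map_star _ a)

variable {B : Type u} [NonUnitalCStarAlgebra B]

/-- The universal property of the free product: existence. -/
noncomputable def lift (f : ∀ i, A i →⋆ₙₐ[ℂ] B) : FreeProduct A →⋆ₙₐ[ℂ] B where
  toFun x := (equivGenerated A x : CoconeProd A) ⟨B, f⟩
  map_smul' c x := by rw [map_smul]; rfl
  map_zero' := by rw [map_zero]; rfl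
  map_add' x y := by rw [map_add]; rfl
  map_mul' x y := by rw [map_mul]; rfl
  map_star' x := by rw [map_star]; rfl

theorem lift_of (f : ∀ i, A i →⋆ₙₐ[ℂ] B) (i : ι) (a : A i) : lift f (of i a) = f i a := by
  change (equivGenerated A ((equivGenerated A).symm _) : CoconeProd A) ⟨B, f⟩ = _
  rw [StarAlgEquiv.apply_symm_apply]
  rfl

/-- The universal property of the free product: uniqueness. -/
theorem hom_ext {f g : FreeProduct A →⋆ₙₐ[ℂ] B} (h : ∀ i a, f (of i a) = g (of i a)) : f = g := by
  have key : ∀ y (hy : y ∈ generated A),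
      f ((equivGenerated A).symm ⟨y, hy⟩) = g ((equivGenerated A).symm ⟨y, hy⟩) := by
    let F : generated A →⋆ₙₐ[ℂ] B := f.comp ((equivGenerated A).symm : generated A →⋆ₙₐ[ℂ] _)
    let G : generated A →⋆ₙₐ[ℂ] B := g.comp ((equivGenerated A).symm : generated A →⋆ₙₐ[ℂ] _)
    have hF : Continuous F := AddMonoidHomClass.continuous_of_bound F 1 fun x => by
      simpa using NonUnitalStarAlgHom.norm_apply_le F x
    have hG : Continuous G := AddMonoidHomClass.continuous_of_bound G 1 fun x => by
      simpa using NonUnitalStarAlgHom.norm_apply_le G x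
    have hadj : ∀ y (_ : y ∈ NonUnitalStarAlgebra.adjoin ℂ (⋃ i, Set.range (toCoconeProd A i)))
        (hy : y ∈ generated A), F ⟨y, hy⟩ = G ⟨y, hy⟩ := by
      intro y hy
      induction hy using NonUnitalStarAlgebra.adjoin_induction with
      | mem x hx =>
        obtain ⟨i, a, rfl⟩ := Set.mem_iUnion.1 hx
        exact fun _ => h i a
      | zero => exact fun _ => (map_zero F).trans (map_zero G).symm
      | add x y hx hy hx' hy' =>
        intro _
        have hx := subset_closure hx
        have hy := subset_closure hy
        exact (map_add F ⟨x, hx⟩ ⟨y, hy⟩).trans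
          ((congrArg₂ _ (hx' hx) (hy' hy)).trans (map_add G ⟨x, hx⟩ ⟨y, hy⟩).symm)
      | mul x y hx hy hx' hy' =>
        intro _
        have hx := subset_closure hx
        have hy := subset_closure hy
        exact (map_mul F ⟨x, hx⟩ ⟨y, hy⟩).trans
          ((congrArg₂ _ (hx' hx) (hy' hy)).trans (map_mul G ⟨x, hx⟩ ⟨y, hy⟩).symm)
      | smul c x hx hx' =>
        intro _
        have hx := subset_closure hx
        exact (map_smul F c ⟨x, hx⟩).trans
          ((congrArg _ (hx' hx)).trans (map_smul G c ⟨x, hx⟩).symm)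
      | star x hx hx' =>
        intro _
        have hx := subset_closure hx
        exact (map_star F ⟨x, hx⟩).trans
          ((congrArg _ (hx' hx)).trans (map_star G ⟨x, hx⟩).symm)
    intro y hy
    obtain ⟨z, hz, hlim⟩ := mem_closure_iff_seq_limit.1 hy
    have hlim' : Filter.Tendsto (fun n => (⟨z n, subset_closure (hz n)⟩ : generated A))
        Filter.atTop (nhds ⟨y, hy⟩) := tendsto_subtype_rng.2 hlim
    refine tendsto_nhds_unique ((hF.tendsto _).comp hlim') ?_
    refine ((hG.tendsto _).comp hlim').congr fun n => ?_
    exact (hadj (z n) (hz n) _).symm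
  ext x
  have := key _ (equivGenerated A x).2
  simpa using this

end FreeProduct

end FreeProduct


/-! ### C⋆-probability spaces and GNS triples -/

/-- A C⋆-probability space: a (not necessarily unital) C⋆-algebra with a state, i.e. a positive
linear functional of norm one. -/
structure CStarProbSpace : Type (u + 1) where
  A : Type u
  [alg : NonUnitalCStarAlgebra A]
  state : A →L[ℂ] ℂ
  state_nonneg : ∀ a, 0 ≤ state (star a * a)
  norm_state : ‖state‖ = 1

attribute [instance] CStarProbSpace.alg

/-- The C⋆-algebra of the probability space has a unit. -/
def CStarProbSpace.IsUnital (S : CStarProbSpace.{u}) : Prop :=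
  ∃ e : S.A, ∀ a : S.A, e * a = a ∧ a * e = a

/-- A GNS triple `(H, σ, ξ)` of a C⋆-probability space. -/
structure GNSTriple (S : CStarProbSpace.{u}) : Type (u + 1) where
  H : Type u
  [normed : NormedAddCommGroup H]
  [inner : InnerProductSpace ℂ H]
  [complete : CompleteSpace H]
  σ : S.A →⋆ₙₐ[ℂ] (H →L[ℂ] H)
  ξ : H
  norm_ξ : ‖ξ‖ = 1
  state_eq : ∀ a, S.state a = ⟪ξ, σ a ξ⟫_ℂ
  cyclic : Dense (Set.range fun a => σ a ξ)

attribute [instance] GNSTriple.normed GNSTriple.inner GNSTriple.complete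

/-- Existence of the GNS triple. -/
theorem GNSTriple.nonempty (S : CStarProbSpace.{u}) : Nonempty (GNSTriple S) := by
  let _ := CStarAlgebra.spectralOrder S.A
  let _ := CStarAlgebra.spectralOrderedRing S.A
  let f : S.A →ₚ[ℂ] ℂ := PositiveLinearMap.mk₀ S.state.toLinearMap fun x hx => by
    obtain ⟨b, rfl⟩ := CStarAlgebra.nonneg_iff_eq_star_mul_self.1 hx
    exact S.state_nonneg b
  have hf : ∀ a, f a = S.state a := fun _ => rfl
  let j : S.A →ₗ[ℂ] f.PreGNS := f.toPreGNS.toLinearMap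
  have hj : ∀ a b, ⟪j a, j b⟫_ℂ = S.state (star a * b) := fun a b => rfl
  have hjn : ∀ a, ‖j a‖ ^ 2 ≤ ‖a‖ ^ 2 := fun a => by
    have h1 : ((‖j a‖ ^ 2 : ℝ) : ℂ) = S.state (star a * a) := by
      rw [← hj, inner_self_eq_norm_sq_to_K]; norm_cast
    have h2 : ‖j a‖ ^ 2 = ‖S.state (star a * a)‖ := by
      rw [← h1, Complex.norm_real, Real.norm_of_nonneg (sq_nonneg _)]
    rw [h2]
    refine (S.state.le_opNorm _).trans ?_
    rw [S.norm_state, one_mul, CStarRing.norm_star_mul_self, sq]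
  have hjn' : ∀ a, ‖j a‖ ≤ ‖a‖ := fun a =>
    (sq_le_sq₀ (norm_nonneg _) (norm_nonneg _)).1 (hjn a)
  have hkad : ∀ a, ‖S.state a‖ ≤ ‖j a‖ := fun a => by
    have hu := CStarAlgebra.increasingApproximateUnit (A := S.A)
    have hlim : Filter.Tendsto (fun e => ‖S.state (e * a)‖) (CStarAlgebra.approximateUnit S.A)
        (nhds ‖S.state a‖) :=
      ((S.state.continuous.tendsto _).comp (hu.tendsto_mul_right a)).norm
    refine le_of_tendsto hlim ?_
    filter_upwards [hu.eventually_star_eq, hu.eventually_norm] with e he hn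
    have : S.state (e * a) = ⟪j e, j a⟫_ℂ := by rw [hj, he]
    rw [this]
    refine (norm_inner_le_norm _ _).trans ?_
    exact mul_le_of_le_one_left (norm_nonneg _) ((hjn' e).trans hn)
  let φ₀ : f.PreGNS →L[ℂ] ℂ := (S.state.toLinearMap ∘ₗ f.ofPreGNS.toLinearMap).mkContinuous 1
    fun x => by rw [one_mul]; exact hkad (f.ofPreGNS x)
  let e : f.PreGNS →L[ℂ] f.GNS := UniformSpace.Completion.toComplL
  have hde : DenseRange e := UniformSpace.Completion.denseRange_coe
  have hue : IsUniformInducing e := UniformSpace.Completion.isUniformInducing_coe _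
  let Φ : f.GNS →L[ℂ] ℂ := φ₀.extend e
  have hΦ : ∀ a, Φ (e (j a)) = S.state a := fun a => φ₀.extend_eq hde hue (j a)
  let ξ : f.GNS := (InnerProductSpace.toDual ℂ f.GNS).symm Φ
  have hξ : ∀ a, ⟪ξ, e (j a)⟫_ℂ = S.state a := fun a => by
    rw [InnerProductSpace.toDual_symm_apply, hΦ]
  have he : ∀ a b, ⟪e (j a), e (j b)⟫_ℂ = S.state (star a * b) := fun a b =>
    (UniformSpace.Completion.inner_coe _ _).trans (hj a b)
  have hσe : ∀ a b, f.gnsNonUnitalStarAlgHom a (e (j b)) = e (j (a * b)) := fun a b =>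
    f.gnsNonUnitalStarAlgHom_apply_coe
  have hdj : ∀ x : f.PreGNS, ∃ a, j a = x := fun x => ⟨f.ofPreGNS x, rfl⟩
  have hσ : ∀ a, f.gnsNonUnitalStarAlgHom a ξ = e (j a) := fun a => by
    refine ext_inner_right ℂ fun v => ?_
    have hc : Continuous fun v : f.GNS => ⟪f.gnsNonUnitalStarAlgHom a ξ, v⟫_ℂ := by fun_prop
    have hc' : Continuous fun v : f.GNS => ⟪e (j a), v⟫_ℂ := by fun_prop
    refine congrFun (hde.equalizer hc hc' (funext fun x => ?_)) v
    obtain ⟨b, rfl⟩ := hdj x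
    change ⟪f.gnsNonUnitalStarAlgHom a ξ, e (j b)⟫_ℂ = ⟪e (j a), e (j b)⟫_ℂ
    rw [← ContinuousLinearMap.adjoint_inner_right, ← ContinuousLinearMap.star_eq_adjoint,
      ← map_star, hσe, hξ, he]
  have hstate : ∀ a, S.state a = ⟪ξ, f.gnsNonUnitalStarAlgHom a ξ⟫_ℂ := fun a => by
    rw [hσ, hξ]
  have hle : ‖ξ‖ ≤ 1 := by
    rw [LinearIsometryEquiv.norm_map]
    refine ContinuousLinearMap.opNorm_le_bound _ zero_le_one fun v => ?_
    rw [one_mul]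
    refine hde.induction_on (p := fun v => ‖Φ v‖ ≤ ‖v‖) v
      (isClosed_le (by fun_prop) (by fun_prop)) fun x => ?_
    obtain ⟨b, rfl⟩ := hdj x
    rw [hΦ]
    exact (hkad b).trans_eq (UniformSpace.Completion.norm_coe _).symm
  have hge : 1 ≤ ‖ξ‖ ^ 2 := by
    rw [← S.norm_state]
    refine ContinuousLinearMap.opNorm_le_bound _ (sq_nonneg _) fun a => ?_
    rw [hstate]
    calc ‖⟪ξ, f.gnsNonUnitalStarAlgHom a ξ⟫_ℂ‖ ≤ ‖ξ‖ * ‖f.gnsNonUnitalStarAlgHom a ξ‖ :=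
          norm_inner_le_norm _ _
      _ ≤ ‖ξ‖ * (‖a‖ * ‖ξ‖) := by
          gcongr
          refine (ContinuousLinearMap.le_opNorm _ _).trans ?_
          gcongr
          exact NonUnitalStarAlgHom.norm_apply_le f.gnsNonUnitalStarAlgHom a
      _ = ‖ξ‖ ^ 2 * ‖a‖ := by ring
  refine ⟨{ H := f.GNS, σ := f.gnsNonUnitalStarAlgHom, ξ := ξ, norm_ξ := ?_,
            state_eq := hstate, cyclic := ?_ }⟩
  · nlinarith [norm_nonneg ξ]
  · have : (fun a => f.gnsNonUnitalStarAlgHom a ξ) = e ∘ j := funext hσ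
    rw [this]
    exact hde.comp (fun x => subset_closure (hdj x)) e.continuous

/-- The GNS triple of a C⋆-probability space (unique up to unitary equivalence). -/
noncomputable def CStarProbSpace.gns (S : CStarProbSpace.{u}) : GNSTriple S :=
  Classical.choice (GNSTriple.nonempty S)

/-! ### The V-monotone product of Hilbert spaces -/

/-- A Hilbert space `H` with a distinguished unit vector `ξ`, together with an orthonormal basis
consisting of `ξ = basis none` and an orthonormal basis `(basis (some k))ₖ` of `H ⊖ ℂ ξ`. -/
structure PointedHilbert : Type (u + 1) where
  H : Type u
  [normed : NormedAddCommGroup H]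
  [inner : InnerProductSpace ℂ H]
  [complete : CompleteSpace H]
  ξ : H
  κ : Type u
  basis : HilbertBasis (Option κ) ℂ H
  basis_none : basis none = ξ

attribute [instance] PointedHilbert.normed PointedHilbert.inner PointedHilbert.complete

/-- A unit vector is part of an orthonormal basis. -/
theorem exists_pointed_basis {H : Type u} [NormedAddCommGroup H] [InnerProductSpace ℂ H]
    [CompleteSpace H] (ξ : H) (hξ : ‖ξ‖ = 1) :
    ∃ (κ : Type u) (b : HilbertBasis (Option κ) ℂ H), b none = ξ := by
  classical
  have hs : Orthonormal ℂ ((↑) : ({ξ} : Set H) → H) :=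
    ⟨fun x => by rw [x.2, hξ], fun x y h => (h (Subsingleton.elim x y)).elim⟩
  obtain ⟨w, b, hw, hb⟩ := hs.exists_hilbertBasis_extension
  have hmem : ξ ∈ w := hw (Set.mem_singleton ξ)
  let x₀ : w := ⟨ξ, hmem⟩
  let e : Option {x : w // x ≠ x₀} ≃ w := Equiv.optionSubtypeNe x₀
  have ho : Orthonormal ℂ (b ∘ e) := b.orthonormal.comp e e.injective
  refine ⟨{x : w // x ≠ x₀}, HilbertBasis.mk ho ?_, ?_⟩
  · rw [Set.range_comp, e.surjective.range_eq, Set.image_univ, b.dense_span]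
  · rw [HilbertBasis.coe_mk, Function.comp_apply, hb]
    simp [e, x₀]

/-- The GNS space with its GNS vector. -/
noncomputable def CStarProbSpace.pointed (S : CStarProbSpace.{u}) : PointedHilbert.{u} where
  H := S.gns.H
  ξ := S.gns.ξ
  κ := (exists_pointed_basis S.gns.ξ S.gns.norm_ξ).choose
  basis := (exists_pointed_basis S.gns.ξ S.gns.norm_ξ).choose_spec.choose
  basis_none := (exists_pointed_basis S.gns.ξ S.gns.norm_ξ).choose_spec.choose_spec

/-- `(i₁, …, iₙ) ∈ Iₙ`: for some `1 ≤ m ≤ n` we have `i₁ > ⋯ > iₘ < ⋯ < iₙ`. -/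
def IsVShaped {ι : Type} [LinearOrder ι] (l : List ι) : Prop :=
  ∃ (l₁ : List ι) (m : ι) (l₂ : List ι), l = l₁ ++ m :: l₂ ∧
    (l₁ ++ [m]).IsChain (· > ·) ∧ (m :: l₂).IsChain (· < ·)

/-- `l` is empty, or `l ∈ Iₙ(i)`, i.e. `l ∈ Iₙ` and either `l` begins with `i` or
`i ∼ l` (meaning that `(i, l) ∈ Iₙ₊₁`). -/
def IsVShapedAt {ι : Type} [LinearOrder ι] (i : ι) (l : List ι) : Prop :=
  l = [] ∨ (IsVShaped l ∧ (l.head? = some i ∨ IsVShaped (i :: l)))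

section Fock

variable {ι : Type} (X : ι → PointedHilbert.{u})

/-- Words `(i₁, k₁) ⋯ (iₙ, kₙ)` with `i₁ ≠ ⋯ ≠ iₙ` and `kᵣ` a label of the orthonormal basis of
`H_{iᵣ} ⊖ ℂ ξ_{iᵣ}`: they label the product basis of the free product of Hilbert spaces. -/
def Word : Type u :=
  {l : List (Σ i, (X i).κ) // (l.map Sigma.fst).IsChain (· ≠ ·)}

/-- The sequence of indices of a word. -/
def Word.indices {X : ι → PointedHilbert.{u}} (w : Word X) : List ι := w.1.map Sigma.fst

/-- The empty word. -/
def Word.nil : Word X := ⟨[], List.isChain_nil⟩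

/-- The free product
`ℂ ξ ⊕ ⨁ₙ ⨁_{i₁ ≠ ⋯ ≠ iₙ} (H_{i₁} ⊖ ℂ ξ_{i₁}) ⊗ ⋯ ⊗ (H_{iₙ} ⊖ ℂ ξ_{iₙ})`
of the Hilbert spaces `(H i, ξ i)`, described through its orthonormal basis of elementary
tensors of basis vectors. -/
abbrev FreeFock : Type u := lp (fun _ : Word X => ℂ) 2

/-- The orthonormal basis of the free product. -/
noncomputable def wordBasis : HilbertBasis (Word X) ℂ (FreeFock X) :=
  HilbertBasis.ofRepr (LinearIsometryEquiv.refl ℂ _)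

/-- The vacuum vector `ξ`. -/
noncomputable def vacuum : FreeFock X := wordBasis X (Word.nil X)

/-- The words which do not begin with the index `i`; they label the basis of the space `𝓕 i`. -/
def WordNot (i : ι) : Type u := {w : Word X // w.indices.head? ≠ some i}

variable {X}

/-- The label of the basis vector `V i (e ⊗ w)`, where `e` is the basis vector of `H i` with label
`o`: the word `w` if `e = ξ i`, and the word `w` with a letter put in front otherwise. -/
def WordNot.cons {i : ι} (w : WordNot X i) : Option (X i).κ → Word X
  | none => w.1
  | some k => ⟨⟨i, k⟩ :: w.1.1, by
      have h1 := w.1.2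
      have h2 := w.2
      rw [Word.indices] at h2
      rw [List.map_cons, List.isChain_cons]
      refine ⟨fun y hy h => h2 ?_, h1⟩
      rw [Option.mem_def] at hy
      rw [hy, ← h]⟩

theorem WordNot.cons_inj {i : ι} {w w' : WordNot X i} {o o' : Option (X i).κ}
    (h : w.cons o = w'.cons o') : w = w' ∧ o = o' := by
  have h' := congrArg Subtype.val h
  cases o <;> cases o' <;> simp only [WordNot.cons] at h'
  · exact ⟨Subtype.ext (Subtype.ext h'), rfl⟩
  · exact (w.2 (by rw [Word.indices, h']; rfl)).elim
  · exact (w'.2 (by rw [Word.indices, ← h']; rfl)).elim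
  · obtain ⟨h1, h2⟩ := List.cons.inj h'
    exact ⟨Subtype.ext (Subtype.ext h2), by simpa using h1⟩

theorem orthonormal_cons {i : ι} (w : WordNot X i) :
    Orthonormal ℂ fun o => wordBasis X (w.cons o) :=
  (wordBasis X).orthonormal.comp _ fun _ _ h => (WordNot.cons_inj h).2

/-- The isometry `x ↦ V i (x ⊗ w)` from `H i` to the free product, for a basis vector `w` of
`𝓕 i`. -/
noncomputable def attach {i : ι} (w : WordNot X i) : (X i).H →ₗᵢ[ℂ] FreeFock X :=
  (orthonormal_cons w).orthogonalFamily.linearIsometry.comp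
    (X i).basis.repr.toLinearIsometry

theorem hasSum_attach {i : ι} (w : WordNot X i) (x : (X i).H) :
    HasSum (fun o => (X i).basis.repr x o • wordBasis X (w.cons o)) (attach w x) :=
  (orthonormal_cons w).orthogonalFamily.hasSum_linearIsometry ((X i).basis.repr x)

theorem attach_basis {i : ι} (w : WordNot X i) (o : Option (X i).κ) :
    attach w ((X i).basis o) = wordBasis X (w.cons o) := by
  classical
  change (orthonormal_cons w).orthogonalFamily.linearIsometry ((X i).basis.repr _) = _
  rw [HilbertBasis.repr_self, OrthogonalFamily.linearIsometry_apply_single]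
  simp

theorem orthogonalFamily_attach (i : ι) :
    OrthogonalFamily ℂ (fun _ : WordNot X i => (X i).H) fun w => attach w := by
  intro w w' hw x y
  have h1 : ∀ o, ⟪wordBasis X (w'.cons o), attach w x⟫_ℂ = 0 := fun o => by
    refine ((hasSum_attach w x).mapL (innerSL ℂ (wordBasis X (w'.cons o)))).unique ?_
    refine HasSum.congr_fun hasSum_zero fun o' => ?_
    rw [innerSL_apply_apply, inner_smul_right,
      (wordBasis X).orthonormal.2 fun h => hw (WordNot.cons_inj h).1.symm, mul_zero]
  refine ((hasSum_attach w' y).mapL (innerSL ℂ (attach w x))).unique ?_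
  refine HasSum.congr_fun hasSum_zero fun o' => ?_
  rw [innerSL_apply_apply, inner_smul_right, inner_eq_zero_symm.1 (h1 o'), mul_zero]

/-- The unitary `V i : H i ⊗ 𝓕 i → 𝓕`, where `H i ⊗ 𝓕 i` is the space of square summable families
in `H i`, indexed by the basis of `𝓕 i`. -/
noncomputable def unitV (i : ι) : lp (fun _ : WordNot X i => (X i).H) 2 →L[ℂ] FreeFock X :=
  (orthogonalFamily_attach i).linearIsometry.toContinuousLinearMap

/-- The operator `T ⊗ id` on `H i ⊗ 𝓕 i`. -/
noncomputable def ampliate (i : ι) (T : (X i).H →L[ℂ] (X i).H) :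
    lp (fun _ : WordNot X i => (X i).H) 2 →L[ℂ] lp (fun _ : WordNot X i => (X i).H) 2 :=
  lp.mapCLM 2 (fun _ => T) (norm_nonneg T) fun _ => le_rfl

/-- Voiculescu's left representation `λ i (T) = V i (T ⊗ id) (V i)⁻¹`. -/
noncomputable def leftRep (i : ι) (T : (X i).H →L[ℂ] (X i).H) : FreeFock X →L[ℂ] FreeFock X :=
  unitV i ∘L ampliate i T ∘L ContinuousLinearMap.adjoint (unitV i)

open Classical in
/-- The orthogonal projection `U i` of the free product onto the closed span of the vacuum and of
the tensors whose sequence of indices belongs to some `Iₙ(i)`. -/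
noncomputable def projU [LinearOrder ι] (i : ι) : FreeFock X →L[ℂ] FreeFock X :=
  lp.mapCLM 2 (fun w => if IsVShapedAt i w.indices then ContinuousLinearMap.id ℂ ℂ else 0)
    zero_le_one fun w => by
      split_ifs
      · exact ContinuousLinearMap.norm_id_le
      · simp

theorem adjoint_unitV_comp (i : ι) :
    ContinuousLinearMap.adjoint (unitV (X := X) i) ∘L unitV i = ContinuousLinearMap.id ℂ _ :=
  (ContinuousLinearMap.norm_map_iff_adjoint_comp_self _).1
    (orthogonalFamily_attach i).linearIsometry.norm_map

theorem Word.exists_cons (i : ι) (v : Word X) :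
    ∃ (w : WordNot X i) (o : Option (X i).κ), w.cons o = v := by
  by_cases hv : v.indices.head? = some i
  · obtain ⟨l, hl⟩ := v
    cases l with
    | nil => cases hv
    | cons p l =>
      obtain ⟨j, k⟩ := p
      obtain rfl : j = i := Option.some.inj hv
      have hc := List.isChain_cons.1 hl
      exact ⟨⟨⟨l, hc.2⟩, fun h => hc.1 j h rfl⟩, some k, rfl⟩
  · exact ⟨⟨v, hv⟩, none, rfl⟩

/-- `V i` is unitary, so that its adjoint is its inverse. -/
theorem unitV_comp_adjoint (i : ι) :
    unitV (X := X) i ∘L ContinuousLinearMap.adjoint (unitV i) = ContinuousLinearMap.id ℂ _ := by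
  classical
  refine lp.ext_continuousLinearMap (ENNReal.ofNat_ne_top (n := nat_lit 2)) fun v => ?_
  ext
  obtain ⟨w, o, rfl⟩ := Word.exists_cons i v
  have h1 : unitV i (lp.single 2 w ((X i).basis o)) = lp.single 2 (w.cons o) (1 : ℂ) := by
    refine ((orthogonalFamily_attach i).linearIsometry_apply_single _).trans ?_
    exact attach_basis w o
  have h2 := DFunLike.congr_fun (adjoint_unitV_comp (X := X) i) (lp.single 2 w ((X i).basis o))
  have h3 : unitV i (ContinuousLinearMap.adjoint (unitV i) (lp.single 2 (w.cons o) (1 : ℂ))) =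
      lp.single 2 (w.cons o) (1 : ℂ) := by
    rw [← h1]
    exact congrArg _ h2
  exact congrArg (fun f : FreeFock X => f _) h3

theorem projU_comp_projU [LinearOrder ι] (i : ι) : projU (X := X) i ∘L projU i = projU i := by
  ext f w
  simp only [projU, ContinuousLinearMap.comp_apply, lp.mapCLM_apply_coe]
  split_ifs <;> simp

theorem adjoint_projU [LinearOrder ι] (i : ι) :
    ContinuousLinearMap.adjoint (projU (X := X) i) = projU i := by
  symm
  rw [ContinuousLinearMap.eq_adjoint_iff]
  intro f g
  rw [lp.inner_eq_tsum, lp.inner_eq_tsum]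
  refine tsum_congr fun w => ?_
  simp only [projU, lp.mapCLM_apply_coe]
  split_ifs <;> simp

theorem IsVShaped.tail [LinearOrder ι] {i : ι} {l : List ι} (h : IsVShaped (i :: l))
    (hl : l ≠ []) : IsVShaped l := by
  obtain ⟨l₁, m, l₂, h, h₁, h₂⟩ := h
  cases l₁ with
  | nil =>
    obtain ⟨rfl, rfl⟩ := List.cons.inj h
    cases l with
    | nil => exact (hl rfl).elim
    | cons j l => exact ⟨[], j, l, rfl, List.isChain_singleton _, h₂.tail⟩
  | cons j l₁ =>
    obtain ⟨rfl, rfl⟩ := List.cons.inj h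
    exact ⟨l₁, m, l₂, rfl, h₁.tail, h₂⟩

theorem isVShapedAt_cons [LinearOrder ι] {i : ι} (w : WordNot X i) (o : Option (X i).κ) :
    IsVShapedAt i (w.cons o).indices ↔ IsVShapedAt i w.1.indices := by
  cases o with
  | none => rfl
  | some k =>
    change IsVShapedAt i (i :: w.1.indices) ↔ _
    have hw := w.2
    by_cases h0 : w.1.indices = []
    · rw [h0]
      exact iff_of_true
        (Or.inr ⟨⟨[], i, [], rfl, List.isChain_singleton _, List.isChain_singleton _⟩, Or.inl rfl⟩)
        (Or.inl rfl)
    · constructor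
      · rintro (h | ⟨h, -⟩)
        · cases h
        · exact Or.inr ⟨h.tail h0, Or.inr h⟩
      · rintro (h | ⟨-, h | h⟩)
        · exact (h0 h).elim
        · exact (hw h).elim
        · exact Or.inr ⟨h, Or.inl rfl⟩

open Classical in
theorem projU_wordBasis [LinearOrder ι] (i : ι) (w : Word X) :
    projU i (wordBasis X w) = if IsVShapedAt i w.indices then wordBasis X w else 0 := by
  change projU i (lp.single 2 w (1 : ℂ)) = if _ then lp.single 2 w (1 : ℂ) else 0
  ext v
  simp only [projU, lp.mapCLM_apply_coe]
  by_cases hv : v = w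
  · subst hv
    split_ifs <;> simp
  · split_ifs <;> simp [hv]

open Classical in
theorem projU_attach [LinearOrder ι] (i : ι) (w : WordNot X i) (x : (X i).H) :
    projU i (attach w x) = if IsVShapedAt i w.1.indices then attach w x else 0 := by
  refine ((hasSum_attach w x).mapL (projU i)).unique ?_
  simp only [map_smul, projU_wordBasis, isVShapedAt_cons]
  split_ifs
  · exact hasSum_attach w x
  · simp

open Classical in
/-- The projection of `H i ⊗ 𝓕 i` corresponding to `U i` under `V i`. -/
noncomputable def projP [LinearOrder ι] (i : ι) :
    lp (fun _ : WordNot X i => (X i).H) 2 →L[ℂ] lp (fun _ : WordNot X i => (X i).H) 2 :=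
  lp.mapCLM 2 (fun w => if IsVShapedAt i w.1.indices then ContinuousLinearMap.id ℂ _ else 0)
    zero_le_one fun w => by
      split_ifs
      · exact ContinuousLinearMap.norm_id_le
      · simp

theorem projU_comp_unitV [LinearOrder ι] (i : ι) :
    projU (X := X) i ∘L unitV i = unitV i ∘L projP i := by
  ext1 f
  refine (((orthogonalFamily_attach i).hasSum_linearIsometry f).mapL (projU i)).unique ?_
  convert (orthogonalFamily_attach i).hasSum_linearIsometry (projP i f) using 2 with w
  rw [projU_attach, projP, lp.mapCLM_apply_coe]
  · split_ifs <;> simp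
  · rfl

theorem adjoint_projP [LinearOrder ι] (i : ι) :
    ContinuousLinearMap.adjoint (projP (X := X) i) = projP i := by
  symm
  rw [ContinuousLinearMap.eq_adjoint_iff]
  intro f g
  rw [lp.inner_eq_tsum, lp.inner_eq_tsum]
  refine tsum_congr fun w => ?_
  simp only [projP, lp.mapCLM_apply_coe]
  split_ifs <;> simp

theorem adjoint_unitV_comp_projU [LinearOrder ι] (i : ι) :
    ContinuousLinearMap.adjoint (unitV (X := X) i) ∘L projU i =
      projP i ∘L ContinuousLinearMap.adjoint (unitV i) := by
  have h := congrArg ContinuousLinearMap.adjoint (projU_comp_unitV (X := X) i)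
  rwa [ContinuousLinearMap.adjoint_comp, ContinuousLinearMap.adjoint_comp, adjoint_projU,
    adjoint_projP] at h

theorem ampliate_comp_projP [LinearOrder ι] (i : ι) (T : (X i).H →L[ℂ] (X i).H) :
    ampliate i T ∘L projP i = projP i ∘L ampliate i T := by
  ext f w
  simp only [ampliate, projP, ContinuousLinearMap.comp_apply, lp.mapCLM_apply_coe]
  split_ifs <;> simp

/-- `λ i (T)` commutes with `U i`. -/
theorem leftRep_comp_projU [LinearOrder ι] (i : ι) (T : (X i).H →L[ℂ] (X i).H) :
    leftRep i T ∘L projU i = projU i ∘L leftRep i T := by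
  rw [leftRep, ContinuousLinearMap.comp_assoc, ContinuousLinearMap.comp_assoc,
    adjoint_unitV_comp_projU, ← ContinuousLinearMap.comp_assoc (ampliate i T),
    ampliate_comp_projP, ContinuousLinearMap.comp_assoc,
    ← ContinuousLinearMap.comp_assoc (unitV i), ← projU_comp_unitV,
    ContinuousLinearMap.comp_assoc]

theorem leftRep_mul (i : ι) (S T : (X i).H →L[ℂ] (X i).H) :
    leftRep i (S * T) = leftRep i S * leftRep i T := by
  have h : ampliate i (S * T) = ampliate i S ∘L ampliate i T := by
    ext f w
    simp [ampliate]
  change _ = leftRep i S ∘L leftRep i T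
  rw [leftRep, leftRep, leftRep, h, ContinuousLinearMap.comp_assoc, ContinuousLinearMap.comp_assoc,
    ContinuousLinearMap.comp_assoc, ← ContinuousLinearMap.comp_assoc _ (unitV i),
    adjoint_unitV_comp, ContinuousLinearMap.id_comp]

theorem leftRep_add (i : ι) (S T : (X i).H →L[ℂ] (X i).H) :
    leftRep i (S + T) = leftRep i S + leftRep i T := by
  have h : ampliate i (S + T) = ampliate i S + ampliate i T := by
    ext f w
    simp [ampliate]
  rw [leftRep, leftRep, leftRep, h, ContinuousLinearMap.add_comp, ContinuousLinearMap.comp_add]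

theorem leftRep_smul (i : ι) (c : ℂ) (T : (X i).H →L[ℂ] (X i).H) :
    leftRep i (c • T) = c • leftRep i T := by
  have h : ampliate i (c • T) = c • ampliate i T := by
    ext f w
    simp [ampliate]
  rw [leftRep, leftRep, h, ContinuousLinearMap.smul_comp, ContinuousLinearMap.comp_smul]

theorem leftRep_star (i : ι) (T : (X i).H →L[ℂ] (X i).H) :
    leftRep i (star T) = star (leftRep i T) := by
  have h : ampliate i (star T) = ContinuousLinearMap.adjoint (ampliate i T) := by
    rw [ContinuousLinearMap.eq_adjoint_iff]
    intro f g
    rw [lp.inner_eq_tsum, lp.inner_eq_tsum]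
    refine tsum_congr fun w => ?_
    simp only [ampliate, lp.mapCLM_apply_coe]
    rw [ContinuousLinearMap.star_eq_adjoint, ContinuousLinearMap.adjoint_inner_left]
  rw [ContinuousLinearMap.star_eq_adjoint (leftRep i T), leftRep, leftRep, h,
    ContinuousLinearMap.adjoint_comp, ContinuousLinearMap.adjoint_comp,
    ContinuousLinearMap.adjoint_adjoint, ContinuousLinearMap.comp_assoc]

/-- The V-monotone left representation `T ↦ U i λ i (T) U i`. The operators are considered on the
whole free product of Hilbert spaces; they map the V-monotone product (the closed span of the vacuum
and of the tensors with sequence of indices in some `Iₙ`) to itself and vanish on its complement. -/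
noncomputable def vRep [LinearOrder ι] (i : ι) :
    ((X i).H →L[ℂ] (X i).H) →⋆ₙₐ[ℂ] (FreeFock X →L[ℂ] FreeFock X) where
  toFun T := projU i * leftRep i T * projU i
  map_smul' c T := by
    rw [leftRep_smul, mul_smul_comm, smul_mul_assoc]; rfl
  map_zero' := by
    have h := leftRep_smul (X := X) i 0 0
    rw [zero_smul, zero_smul] at h
    rw [h, mul_zero, zero_mul]
  map_add' S T := by rw [leftRep_add, mul_add, add_mul]
  map_mul' S T := by
    have hU : projU (X := X) i * projU i = projU i := projU_comp_projU i
    have hT : leftRep i T * projU i = projU i * leftRep i T := leftRep_comp_projU i T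
    rw [leftRep_mul]
    calc projU i * (leftRep i S * leftRep i T) * projU i
        = projU i * leftRep i S * (leftRep i T * projU i) := by simp only [mul_assoc]
      _ = projU i * leftRep i S * ((projU i * projU i) * (leftRep i T * projU i)) := by
          rw [hU, hT, ← mul_assoc (projU i) (projU i), hU]
      _ = _ := by simp only [mul_assoc]
  map_star' T := by
    have hU : star (projU (X := X) i) = projU i := adjoint_projU i
    rw [leftRep_star, star_mul, star_mul, hU, mul_assoc]

theorem vRep_vacuum [LinearOrder ι] (i : ι) (T : (X i).H →L[ℂ] (X i).H) :
    ⟪vacuum X, vRep i T (vacuum X)⟫_ℂ = ⟪(X i).ξ, T (X i).ξ⟫_ℂ := by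
  classical
  let w : WordNot X i := ⟨Word.nil X, by simp [Word.nil, Word.indices]⟩
  have h1 : vacuum X = unitV i (lp.single 2 w (X i).ξ) := by
    refine Eq.trans ?_ ((orthogonalFamily_attach i).linearIsometry_apply_single _).symm
    rw [← (X i).basis_none, attach_basis]
    rfl
  have h2 : projU i (vacuum X) = vacuum X := by
    rw [vacuum, projU_wordBasis]
    exact if_pos (Or.inl rfl)
  have h3 : ampliate i T (lp.single 2 w (X i).ξ) = lp.single 2 w (T (X i).ξ) := by
    ext v
    simp only [ampliate, lp.mapCLM_apply_coe]
    by_cases hv : v = w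
    · subst hv; simp
    · simp [hv]
  have h4 : ∀ f, ContinuousLinearMap.adjoint (unitV (X := X) i) (unitV i f) = f := fun f =>
    DFunLike.congr_fun (adjoint_unitV_comp (X := X) i) f
  calc ⟪vacuum X, vRep i T (vacuum X)⟫_ℂ
      = ⟪vacuum X, projU i (leftRep i T (projU i (vacuum X)))⟫_ℂ := rfl
    _ = ⟪vacuum X, leftRep i T (vacuum X)⟫_ℂ := by
        rw [h2, ← adjoint_projU, ContinuousLinearMap.adjoint_inner_right, h2]
    _ = ⟪lp.single 2 w (X i).ξ, ampliate i T (lp.single 2 w (X i).ξ)⟫_ℂ := by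
        rw [leftRep, ContinuousLinearMap.comp_apply, ContinuousLinearMap.comp_apply,
          ← ContinuousLinearMap.adjoint_inner_left, h1, h4]
    _ = _ := by
        rw [h3, lp.inner_single_left, lp.single_apply_self]

end Fock

/-! ### The V-monotone product of states -/

section Product

variable {ι : Type} [LinearOrder ι] (S : ι → CStarProbSpace.{u})

/-- The representation of the free product of the algebras given by the V-monotone left
representations composed with the GNS representations. -/
noncomputable def vProductRep : FreeProduct (fun i => (S i).A) →⋆ₙₐ[ℂ]
    (FreeFock (fun i => (S i).pointed) →L[ℂ] FreeFock (fun i => (S i).pointed)) :=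
  FreeProduct.lift fun i =>
    (vRep (X := fun i => (S i).pointed) i).comp (S i).gns.σ

/-- The functional `x ↦ ⟨ξ, π(x) ξ⟩`, with `ξ` the vacuum vector and `π` the representation
`vProductRep`. -/
noncomputable def vProductState : FreeProduct (fun i => (S i).A) →L[ℂ] ℂ :=
  LinearMap.mkContinuous
    { toFun := fun x => ⟪vacuum _, vProductRep S x (vacuum _)⟫_ℂ
      map_add' := fun x y => by rw [map_add, add_apply, inner_add_right]
      map_smul' := fun c x => by
        rw [map_smul, smul_apply, inner_smul_right]; rfl }
    1 fun x => by
      have hv : ‖vacuum fun i => (S i).pointed‖ = 1 := (wordBasis _).orthonormal.1 _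
      refine (norm_inner_le_norm (𝕜 := ℂ) (vacuum _) (vProductRep S x (vacuum _))).trans ?_
      rw [hv, one_mul, one_mul]
      refine (ContinuousLinearMap.le_opNorm _ _).trans ?_
      rw [hv, mul_one]
      exact NonUnitalStarAlgHom.norm_apply_le (vProductRep S) x

theorem vProductState_of (i : ι) (a : (S i).A) :
    vProductState S (FreeProduct.of (A := fun i => (S i).A) i a) = (S i).state a := by
  change ⟪vacuum _, vProductRep S (FreeProduct.of (A := fun i => (S i).A) i a) (vacuum _)⟫_ℂ = _
  rw [vProductRep, FreeProduct.lift_of, (S i).gns.state_eq]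
  exact vRep_vacuum (X := fun i => (S i).pointed) i _

/-- The V-monotone product `⋁ᵢ (A i, φ i)` of C⋆-probability spaces: the free product of the algebras
without identification of units, with the V-monotone product of the states. -/
noncomputable def vProduct [Nonempty ι] : CStarProbSpace.{u} where
  A := FreeProduct fun i => (S i).A
  state := vProductState S
  state_nonneg x := by
    change 0 ≤ ⟪vacuum _, vProductRep S (star x * x) (vacuum _)⟫_ℂ
    rw [map_mul, map_star, mul_apply_eq_comp, ContinuousLinearMap.star_eq_adjoint,
      ContinuousLinearMap.adjoint_inner_right]
    rw [inner_self_eq_norm_sq_to_K]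
    norm_cast
    exact Complex.zero_le_real.2 (sq_nonneg _)
  norm_state := by
    obtain ⟨i⟩ := ‹Nonempty ι›
    refine le_antisymm (LinearMap.mkContinuous_norm_le _ zero_le_one _) ?_
    rw [← (S i).norm_state]
    refine ContinuousLinearMap.opNorm_le_bound _ (norm_nonneg _) fun a => ?_
    rw [← vProductState_of]
    refine (ContinuousLinearMap.le_opNorm _ _).trans ?_
    gcongr
    exact NonUnitalStarAlgHom.norm_apply_le (FreeProduct.of (A := fun i => (S i).A) i) a

end Product

namespace CStarProbSpace

/-- The family `(S, T)` indexed by the two-element ordered set `{0 < 1}`. -/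
abbrev pair (S T : CStarProbSpace.{u}) : Fin 2 → CStarProbSpace.{u}
  | 0 => S
  | 1 => T

/-- The V-monotone product of two C⋆-probability spaces. -/
noncomputable def vprod (S T : CStarProbSpace.{u}) : CStarProbSpace.{u} := vProduct (pair S T)

/-- The canonical embedding of the first algebra into the free product. -/
noncomputable def inl {S T : CStarProbSpace.{u}} : S.A →⋆ₙₐ[ℂ] (S.vprod T).A :=
  FreeProduct.of (A := fun i => (pair S T i).A) 0

/-- The canonical embedding of the second algebra into the free product. -/
noncomputable def inr {S T : CStarProbSpace.{u}} : T.A →⋆ₙₐ[ℂ] (S.vprod T).A :=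
  FreeProduct.of (A := fun i => (pair S T i).A) 1

/-- A pair of ⋆-homomorphisms as a family indexed by `{0 < 1}`. -/
def descFam {S T : CStarProbSpace.{u}} {B : Type u} [NonUnitalCStarAlgebra B]
    (f : S.A →⋆ₙₐ[ℂ] B) (g : T.A →⋆ₙₐ[ℂ] B) : ∀ i : Fin 2, (pair S T i).A →⋆ₙₐ[ℂ] B
  | 0 => f
  | 1 => g

/-- The ⋆-homomorphism on the free product with given restrictions to the two algebras. -/
noncomputable def desc {S T : CStarProbSpace.{u}} {B : Type u} [NonUnitalCStarAlgebra B]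
    (f : S.A →⋆ₙₐ[ℂ] B) (g : T.A →⋆ₙₐ[ℂ] B) : (S.vprod T).A →⋆ₙₐ[ℂ] B :=
  FreeProduct.lift (A := fun i => (pair S T i).A) (descFam f g)

section

variable {S T : CStarProbSpace.{u}} {B : Type u} [NonUnitalCStarAlgebra B]

@[simp]
theorem desc_inl (f : S.A →⋆ₙₐ[ℂ] B) (g : T.A →⋆ₙₐ[ℂ] B) (a : S.A) : desc f g (inl a) = f a :=
  FreeProduct.lift_of (A := fun i => (pair S T i).A) (descFam f g) 0 a

@[simp]
theorem desc_inr (f : S.A →⋆ₙₐ[ℂ] B) (g : T.A →⋆ₙₐ[ℂ] B) (a : T.A) : desc f g (inr a) = g a :=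
  FreeProduct.lift_of (A := fun i => (pair S T i).A) (descFam f g) 1 a

theorem vprod_hom_ext {f g : (S.vprod T).A →⋆ₙₐ[ℂ] B} (h₁ : ∀ a, f (inl a) = g (inl a))
    (h₂ : ∀ a, f (inr a) = g (inr a)) : f = g :=
  FreeProduct.hom_ext (A := fun i => (pair S T i).A) fun
    | 0 => h₁
    | 1 => h₂

end

/-- The canonical isomorphism `(A₁ ⊔ A₂) ⊔ A₃ ≃ A₁ ⊔ (A₂ ⊔ A₃)`, which is the identity on
`A₁`, `A₂` and `A₃`. -/
noncomputable def assoc (S₁ S₂ S₃ : CStarProbSpace.{u}) :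
    ((S₁.vprod S₂).vprod S₃).A ≃⋆ₐ[ℂ] (S₁.vprod (S₂.vprod S₃)).A :=
  let F : ((S₁.vprod S₂).vprod S₃).A →⋆ₙₐ[ℂ] (S₁.vprod (S₂.vprod S₃)).A :=
    desc (desc inl (inr.comp inl)) (inr.comp inr)
  let G : (S₁.vprod (S₂.vprod S₃)).A →⋆ₙₐ[ℂ] ((S₁.vprod S₂).vprod S₃).A :=
    desc (inl.comp inl) (desc (inl.comp inr) inr)
  have hGF : G.comp F = NonUnitalStarAlgHom.id ℂ _ := by
    refine vprod_hom_ext (fun a => ?_) fun a => by simp [F, G]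
    refine DFunLike.congr_fun (f := (G.comp F).comp inl) (g := inl) ?_ a
    exact vprod_hom_ext (fun a => by simp [F, G]) fun a => by simp [F, G]
  have hFG : F.comp G = NonUnitalStarAlgHom.id ℂ _ := by
    refine vprod_hom_ext (fun a => by simp [F, G]) fun a => ?_
    refine DFunLike.congr_fun (f := (F.comp G).comp inr) (g := inr) ?_ a
    exact vprod_hom_ext (fun a => by simp [F, G]) fun a => by simp [F, G]
  { toFun := F
    invFun := G
    left_inv := fun x => DFunLike.congr_fun hGF x
    right_inv := fun x => DFunLike.congr_fun hFG x
    map_add' := map_add F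
    map_mul' := map_mul F
    map_smul' := map_smul F
    map_star' := map_star F }

section

variable {S₁ S₂ S₃ : CStarProbSpace.{u}}

@[simp]
theorem assoc_inl_inl (a : S₁.A) : assoc S₁ S₂ S₃ (inl (inl a)) = inl a := by
  change desc (desc inl (inr.comp inl)) (inr.comp inr) (inl (inl a)) = _
  simp

@[simp]
theorem assoc_inl_inr (b : S₂.A) : assoc S₁ S₂ S₃ (inl (inr b)) = inr (inl b) := by
  change desc (desc inl (inr.comp inl)) (inr.comp inr) (inl (inr b)) = _
  simp

@[simp]
theorem assoc_inr (c : S₃.A) : assoc S₁ S₂ S₃ (inr c) = inr (inr c) := by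
  change desc (desc inl (inr.comp inl)) (inr.comp inr) (inr c) = _
  simp

end

end CStarProbSpace

end VMonotone

open VMonotone VMonotone.CStarProbSpace

/-!
For `i ≠ j` the sequences `(j)` and `(i, j)` are V-shaped, so on the vacuum and on tensors of length
one the V-monotone representations act as the free ones. Hence `⟨ξ, a b a' ξ⟩ = φ (a a') ψ (b)` when
`a, a'` come from one factor and `b` from the other, whatever the order of the two factors
(`inner_embed_vRep_embed`, `inner_vacuum_vRep_three`). Applied twice, this gives the moment of
`a₁ c₁ b c₂ a₂` for the bracketing `φ₁ ∨ (φ₂ ∨ φ₃)`, where `c₁ b c₂` is a single element.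

For the other bracketing, `a₁`, `b`, `a₂` have the smaller index `i` and `c₁`, `c₂` the larger index
`j`. The sequence `(i, j, i)` is a peak, so that `U i` annihilates the tensors with sequence `(j, i)`
(`projU_letter`). Therefore `b` only sees the following part of `c₂ a₂ ξ`
(`projU_vRep_embed`): `ψ (c₂) a₂ ξ + φ (a₂) (c₂ ξ - ψ (c₂) ξ)`; similarly for `c₁⋆ a₁⋆ ξ` on the
other side. The inner product of the two (`inner_vacuum_vRep_five`) is
`ψ (c₁) ψ (c₂) φ (a₁ b a₂) + φ (a₁) φ (b) φ (a₂) (ψ (c₁ c₂) - ψ (c₁) ψ (c₂))`, and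
`φ (a₁ b a₂)` is again a moment of length three.

The two moments differ by the product of `φ₂ (b)` and the covariances of `a₁, a₂` and of `c₁, c₂`,
which is nonzero for a projection of expectation `1 / 2` in each factor (`fairCoin`, `head`).
-/

namespace VMonotone

/-! ### V-shaped sequences of length at most two -/

section Shapes

variable {ι : Type} [LinearOrder ι]

theorem isVShapedAt_nil (i : ι) : IsVShapedAt i [] :=
  Or.inl rfl

theorem isVShaped_singleton (i : ι) : IsVShaped [i] :=
  ⟨[], i, [], rfl, List.isChain_singleton _, List.isChain_singleton _⟩

theorem isVShaped_pair {i j : ι} (h : i ≠ j) : IsVShaped [i, j] := by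
  rcases lt_or_gt_of_ne h with h | h
  · exact ⟨[], i, [j], rfl, List.isChain_singleton _, List.isChain_pair.2 h⟩
  · exact ⟨[i], j, [], rfl, List.isChain_pair.2 h, List.isChain_singleton _⟩

theorem isVShapedAt_singleton {i j : ι} (h : i ≠ j) : IsVShapedAt i [j] :=
  Or.inr ⟨isVShaped_singleton j, Or.inr (isVShaped_pair h)⟩

/-- A peak is not V-shaped. -/
theorem not_isVShaped_peak {i j k : ι} (hij : i < j) (hkj : k < j) : ¬ IsVShaped [i, j, k] := by
  rintro ⟨_ | ⟨x, _ | ⟨y, l⟩⟩, m, l₂, h, h₁, h₂⟩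
  · obtain ⟨rfl, rfl⟩ := List.cons.inj h
    exact (List.isChain_cons_cons.1 (List.isChain_cons_cons.1 h₂).2).1.not_gt hkj
  · obtain ⟨rfl, h'⟩ := List.cons.inj h
    obtain ⟨rfl, -⟩ := List.cons.inj h'
    exact (List.isChain_cons_cons.1 h₁).1.not_gt hij
  · obtain ⟨rfl, h'⟩ := List.cons.inj h
    obtain ⟨rfl, -⟩ := List.cons.inj h'
    exact (List.isChain_cons_cons.1 h₁).1.not_gt hij

theorem not_isVShapedAt_pair {i j : ι} (h : i < j) : ¬ IsVShapedAt i [j, i] := by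
  rintro (h' | ⟨-, h' | h'⟩)
  · cases h'
  · exact h.ne' (Option.some.inj h')
  · exact not_isVShaped_peak h h h'

end Shapes

/-! ### The left representations on tensors of length at most two -/

theorem _root_.HilbertBasis.ext_clm {ι H F : Type*} [NormedAddCommGroup H] [InnerProductSpace ℂ H]
    [NormedAddCommGroup F] [NormedSpace ℂ F] (b : HilbertBasis ι ℂ H) {f g : H →L[ℂ] F}
    (h : ∀ o, f (b o) = g (b o)) : f = g :=
  ContinuousLinearMap.ext_on (Submodule.dense_iff_topologicalClosure_eq_top.2 b.dense_span)
    (by rintro _ ⟨o, rfl⟩; exact h o)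

theorem _root_.HilbertBasis.ext_operator {ι H : Type*} [NormedAddCommGroup H]
    [InnerProductSpace ℂ H] (b : HilbertBasis ι ℂ H) {f g : H →L[ℂ] H}
    (h : ∀ o o', ⟪b o, f (b o')⟫_ℂ = ⟪b o, g (b o')⟫_ℂ) : f = g :=
  b.ext_clm fun o' => b.repr.injective <| lp.ext <| funext fun o => by
    rw [b.repr_apply_apply, b.repr_apply_apply, h]

section Fock

variable {ι : Type} {X : ι → PointedHilbert.{u}}

theorem PointedHilbert.norm_ξ (Y : PointedHilbert.{u}) : ‖Y.ξ‖ = 1 := by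
  rw [← Y.basis_none]
  exact Y.basis.orthonormal.1 none

theorem PointedHilbert.inner_ξ_ξ (Y : PointedHilbert.{u}) : ⟪Y.ξ, Y.ξ⟫_ℂ = 1 := by
  rw [inner_self_eq_norm_sq_to_K, Y.norm_ξ]
  simp

theorem PointedHilbert.inner_ξ_basis_some (Y : PointedHilbert.{u}) (k : Y.κ) :
    ⟪Y.ξ, Y.basis (some k)⟫_ℂ = 0 := by
  rw [← Y.basis_none]
  exact Y.basis.orthonormal.2 (Option.some_ne_none k).symm

theorem attach_ξ {i : ι} (w : WordNot X i) : attach w (X i).ξ = wordBasis X w.1 := by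
  rw [← (X i).basis_none, attach_basis]
  rfl

/-- The empty word as a label of a basis vector of `𝓕 i`. -/
def nilNot (X : ι → PointedHilbert.{u}) (i : ι) : WordNot X i :=
  ⟨Word.nil X, by simp [Word.nil, Word.indices]⟩

/-- The word of length one with index `i` and label `k`, as a label of a basis vector of `𝓕 j`. -/
def letterNot {i j : ι} (h : i ≠ j) (k : (X i).κ) : WordNot X j :=
  ⟨(nilNot X i).cons (some k), fun h' => h (Option.some.inj h')⟩

/-- The embedding of `H i` into the free product which sends `ξ i` to the vacuum vector. -/
noncomputable def embed (X : ι → PointedHilbert.{u}) (i : ι) : (X i).H →ₗᵢ[ℂ] FreeFock X :=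
  attach (nilNot X i)

theorem embed_ξ (i : ι) : embed X i (X i).ξ = vacuum X :=
  attach_ξ _

theorem embed_basis_some {i j : ι} (h : i ≠ j) (k : (X i).κ) :
    embed X i ((X i).basis (some k)) = attach (letterNot h k) (X j).ξ := by
  rw [embed, attach_basis, attach_ξ]
  rfl

theorem inner_attach_self {i : ι} (w : WordNot X i) (x y : (X i).H) :
    ⟪attach w x, attach w y⟫_ℂ = ⟪x, y⟫_ℂ :=
  (attach w).inner_map_map x y

theorem inner_attach_of_ne {i : ι} {w w' : WordNot X i} (h : w ≠ w') (x y : (X i).H) :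
    ⟪attach w x, attach w' y⟫_ℂ = 0 :=
  orthogonalFamily_attach i h x y

theorem letterNot_ne_nilNot {i j : ι} (h : i ≠ j) (k : (X i).κ) :
    letterNot h k ≠ nilNot X j := fun h' =>
  List.cons_ne_nil _ _ (congrArg (fun w : WordNot X j => w.1.1) h')

theorem letterNot_injective {i j : ι} (h : i ≠ j) :
    Function.Injective (letterNot (X := X) h) := fun k k' h' =>
  Option.some.inj (WordNot.cons_inj (w := nilNot X i) (w' := nilNot X i) (o := some k)
    (o' := some k') (congrArg (fun w : WordNot X j => w.1) h')).2

theorem leftRep_attach {i : ι} (w : WordNot X i) (T : (X i).H →L[ℂ] (X i).H) (x : (X i).H) :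
    leftRep i T (attach w x) = attach w (T x) := by
  classical
  have h1 : ∀ y, attach w y = unitV i (lp.single 2 w y) := fun y =>
    ((orthogonalFamily_attach i).linearIsometry_apply_single y).symm
  have h2 : ∀ f, ContinuousLinearMap.adjoint (unitV (X := X) i) (unitV i f) = f := fun f =>
    DFunLike.congr_fun (adjoint_unitV_comp (X := X) i) f
  have h3 : ampliate i T (lp.single 2 w x) = lp.single 2 w (T x) := by
    ext v
    simp only [ampliate, lp.mapCLM_apply_coe]
    by_cases hv : v = w
    · subst hv; simp
    · simp [hv]
  rw [leftRep, ContinuousLinearMap.comp_apply, ContinuousLinearMap.comp_apply, h1, h2, h3, h1]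

theorem inner_embed_embed {i j : ι} (h : i ≠ j) (x : (X i).H) {y : (X j).H}
    (hy : ⟪(X j).ξ, y⟫_ℂ = 0) : ⟪embed X i x, embed X j y⟫_ℂ = 0 := by
  refine DFunLike.congr_fun (f := innerSL ℂ (embed X j y) ∘L (embed X i).toContinuousLinearMap)
    (g := 0) ?_ x |> inner_eq_zero_symm.1
  refine (X i).basis.ext_clm fun o => ?_
  change ⟪embed X j y, embed X i ((X i).basis o)⟫_ℂ = 0
  cases o with
  | none =>
    rw [(X i).basis_none, embed_ξ, ← embed_ξ j, LinearIsometry.inner_map_map,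
      inner_eq_zero_symm.1 hy]
  | some k =>
    rw [embed_basis_some h, embed, inner_attach_of_ne (letterNot_ne_nilNot h k).symm]

variable [LinearOrder ι]

theorem projU_attach_of_isVShapedAt {i : ι} {w : WordNot X i} (hw : IsVShapedAt i w.1.indices)
    (x : (X i).H) : projU i (attach w x) = attach w x := by
  rw [projU_attach, if_pos hw]

theorem vRep_attach {i : ι} {w : WordNot X i} (hw : IsVShapedAt i w.1.indices)
    (T : (X i).H →L[ℂ] (X i).H) (x : (X i).H) : vRep i T (attach w x) = attach w (T x) := by
  change projU i (leftRep i T (projU i (attach w x))) = _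
  rw [projU_attach_of_isVShapedAt hw, leftRep_attach, projU_attach_of_isVShapedAt hw]

theorem vRep_embed (i : ι) (T : (X i).H →L[ℂ] (X i).H) (x : (X i).H) :
    vRep i T (embed X i x) = embed X i (T x) :=
  vRep_attach (isVShapedAt_nil i) T x

theorem vRep_apply_vacuum (i : ι) (T : (X i).H →L[ℂ] (X i).H) :
    vRep i T (vacuum X) = embed X i (T (X i).ξ) := by
  rw [← embed_ξ i, vRep_embed]

theorem vRep_letter {i j : ι} (h : i ≠ j) (T : (X j).H →L[ℂ] (X j).H) (k : (X i).κ)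
    (y : (X j).H) : vRep j T (attach (letterNot h k) y) = attach (letterNot h k) (T y) :=
  vRep_attach (isVShapedAt_singleton h.symm) T y

theorem projU_vRep (i : ι) (T : (X i).H →L[ℂ] (X i).H) (f : FreeFock X) :
    projU i (vRep i T f) = vRep i T f :=
  DFunLike.congr_fun (projU_comp_projU (X := X) i) (leftRep i T (projU i f))

theorem vRep_projU (i : ι) (T : (X i).H →L[ℂ] (X i).H) (f : FreeFock X) :
    vRep i T (projU i f) = vRep i T f :=
  congrArg (fun g => projU i (leftRep i T g)) (DFunLike.congr_fun (projU_comp_projU (X := X) i) f)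

theorem inner_vRep_left (i : ι) (T : (X i).H →L[ℂ] (X i).H) (f g : FreeFock X) :
    ⟪vRep i (star T) f, g⟫_ℂ = ⟪f, vRep i T g⟫_ℂ := by
  rw [map_star, ContinuousLinearMap.star_eq_adjoint, ContinuousLinearMap.adjoint_inner_left]

/-- Compressed to the copy of `H i`, an operator on another space `H j` acts as a scalar: on
`H i ⊖ ℂ ξ i` it creates a tensor factor in front, of which only the vacuum part remains. -/
theorem inner_embed_vRep_embed {i j : ι} (h : i ≠ j) (T : (X j).H →L[ℂ] (X j).H)
    (x y : (X i).H) :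
    ⟪embed X i x, vRep j T (embed X i y)⟫_ℂ = ⟪x, y⟫_ℂ * ⟪(X j).ξ, T (X j).ξ⟫_ℂ := by
  let E := (embed X i).toContinuousLinearMap
  have hE : ∀ y, E y = embed X i y := fun _ => rfl
  have key : ∀ o o', ⟪embed X i ((X i).basis o), vRep j T (embed X i ((X i).basis o'))⟫_ℂ =
      ⟪(X i).basis o, (X i).basis o'⟫_ℂ * ⟪(X j).ξ, T (X j).ξ⟫_ℂ := by
    have hn : ∀ k, ⟪(X i).basis (some k), (X i).basis none⟫_ℂ = 0 := fun k =>
      (X i).basis.orthonormal.2 (Option.some_ne_none k)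
    have hn' : ∀ k, ⟪(X i).basis none, (X i).basis (some k)⟫_ℂ = 0 := fun k =>
      (X i).basis.orthonormal.2 (Option.some_ne_none k).symm
    have h0 : embed X i ((X i).basis none) = attach (nilNot X j) (X j).ξ := by
      rw [(X i).basis_none, embed_ξ, ← embed_ξ j, embed]
    have hv : ∀ y, vRep j T (attach (nilNot X j) y) = attach (nilNot X j) (T y) :=
      vRep_embed j T
    rintro (_ | k) (_ | k')
    · rw [h0, hv, inner_attach_self, (X i).basis_none, PointedHilbert.inner_ξ_ξ, one_mul]
    · rw [h0, embed_basis_some h, vRep_letter, hn', zero_mul,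
        inner_attach_of_ne (letterNot_ne_nilNot h k').symm]
    · rw [h0, embed_basis_some h, hv, hn, zero_mul, inner_attach_of_ne (letterNot_ne_nilNot h k)]
    · rw [embed_basis_some h, embed_basis_some h, vRep_letter]
      by_cases hk : k = k'
      · subst hk
        rw [inner_attach_self, inner_self_eq_norm_sq_to_K, (X i).basis.orthonormal.1]
        simp
      · rw [inner_attach_of_ne fun h' => hk (letterNot_injective h h'),
          (X i).basis.orthonormal.2 fun h' => hk (Option.some.inj h'), zero_mul]
  have h1 : ContinuousLinearMap.adjoint E ∘L vRep j T ∘L E =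
      ⟪(X j).ξ, T (X j).ξ⟫_ℂ • ContinuousLinearMap.id ℂ _ := by
    refine (X i).basis.ext_operator fun o o' => ?_
    rw [ContinuousLinearMap.comp_apply, ContinuousLinearMap.comp_apply,
      ContinuousLinearMap.adjoint_inner_right, hE, hE, key, smul_apply,
      ContinuousLinearMap.id_apply, inner_smul_right, mul_comm]
  have h2 := congrArg (fun f : (X i).H →L[ℂ] (X i).H => ⟪x, f y⟫_ℂ) h1
  simp only [ContinuousLinearMap.comp_apply, ContinuousLinearMap.adjoint_inner_right] at h2
  rw [hE, hE] at h2
  rw [h2, smul_apply, ContinuousLinearMap.id_apply, inner_smul_right, mul_comm]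

/-- `U i` removes the tensors with sequence of indices `(j, i)` if `i < j`. -/
theorem projU_letter {i j : ι} (h : i < j) (k : (X i).κ) (y : (X j).H) :
    projU i (attach (letterNot h.ne k) y) =
      ⟪(X j).ξ, y⟫_ℂ • embed X i ((X i).basis (some k)) := by
  refine DFunLike.congr_fun (f := projU i ∘L (attach (letterNot h.ne k)).toContinuousLinearMap)
    (g := (innerSL ℂ (X j).ξ).smulRight (embed X i ((X i).basis (some k)))) ?_ y
  refine (X j).basis.ext_clm fun o => ?_
  change projU i (attach (letterNot h.ne k) ((X j).basis o)) = ⟪(X j).ξ, (X j).basis o⟫_ℂ • _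
  cases o with
  | none =>
    rw [(X j).basis_none, PointedHilbert.inner_ξ_ξ, one_smul, ← embed_basis_some, embed,
      projU_attach_of_isVShapedAt (isVShapedAt_nil i)]
  | some l =>
    rw [PointedHilbert.inner_ξ_basis_some, zero_smul, attach_basis, projU_wordBasis,
      if_neg (show ¬ IsVShapedAt i ((letterNot h.ne k).cons (some l)).indices from
        not_isVShapedAt_pair h)]

/-- The vacuum and the tensors of index `j` belong to the range of `U i`. -/
theorem projU_embed {i j : ι} (h : i ≠ j) (y : (X j).H) :
    projU i (embed X j y) = embed X j y := by
  refine DFunLike.congr_fun (f := projU i ∘L (embed X j).toContinuousLinearMap)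
    (g := (embed X j).toContinuousLinearMap) ?_ y
  refine (X j).basis.ext_clm fun o => ?_
  change projU i (embed X j ((X j).basis o)) = embed X j ((X j).basis o)
  rw [embed, attach_basis, projU_wordBasis, if_pos]
  cases o with
  | none => exact isVShapedAt_nil i
  | some l => exact isVShapedAt_singleton h

/-- For `i < j`, the part of `U j λ j (T) U j x` in the range of `U i`, for `x` in the copy of
`H i`: the tensors with sequence of indices `(j, i)` are lost. -/
theorem projU_vRep_embed {i j : ι} (h : i < j) (T : (X j).H →L[ℂ] (X j).H) (x : (X i).H) :
    projU i (vRep j T (embed X i x)) =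
      ⟪(X j).ξ, T (X j).ξ⟫_ℂ • embed X i x + ⟪(X i).ξ, x⟫_ℂ •
        embed X j (T (X j).ξ - ⟪(X j).ξ, T (X j).ξ⟫_ℂ • (X j).ξ) := by
  refine DFunLike.congr_fun
    (f := projU i ∘L vRep j T ∘L (embed X i).toContinuousLinearMap)
    (g := ⟪(X j).ξ, T (X j).ξ⟫_ℂ • (embed X i).toContinuousLinearMap +
      (innerSL ℂ (X i).ξ).smulRight
        (embed X j (T (X j).ξ - ⟪(X j).ξ, T (X j).ξ⟫_ℂ • (X j).ξ))) ?_ x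
  refine (X i).basis.ext_clm fun o => ?_
  change projU i (vRep j T (embed X i ((X i).basis o))) =
    ⟪(X j).ξ, T (X j).ξ⟫_ℂ • embed X i ((X i).basis o) + ⟪(X i).ξ, (X i).basis o⟫_ℂ • _
  cases o with
  | none =>
    rw [(X i).basis_none, embed_ξ, vRep_apply_vacuum, projU_embed h.ne, PointedHilbert.inner_ξ_ξ,
      one_smul, map_sub, map_smul, embed_ξ, add_sub_cancel]
  | some k =>
    rw [PointedHilbert.inner_ξ_basis_some, zero_smul, add_zero, embed_basis_some h.ne,
      vRep_letter, projU_letter h, embed_basis_some h.ne]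

end Fock

/-! ### Mixed moments of vacuum states -/

section Moments

variable {ι : Type} {X : ι → PointedHilbert.{u}} [LinearOrder ι]

/-- A moment of length three: the middle factor contributes its expectation. -/
theorem inner_vacuum_vRep_three {i j : ι} (h : i ≠ j) (S S' : (X i).H →L[ℂ] (X i).H)
    (T : (X j).H →L[ℂ] (X j).H) :
    ⟪vacuum X, vRep i S (vRep j T (vRep i S' (vacuum X)))⟫_ℂ =
      ⟪(X i).ξ, S (S' (X i).ξ)⟫_ℂ * ⟪(X j).ξ, T (X j).ξ⟫_ℂ := by
  rw [← inner_vRep_left, vRep_apply_vacuum, vRep_apply_vacuum, inner_embed_vRep_embed h,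
    ContinuousLinearMap.star_eq_adjoint, ContinuousLinearMap.adjoint_inner_left]

/-- A moment of length five with outer index `i < j`. In the middle only the vacuum and the tensors
of length one survive, because no tensor with sequence of indices `(j, i)` is in the range of
`U i`. -/
theorem inner_vacuum_vRep_five {i j : ι} (h : i < j) (A₁ B A₂ : (X i).H →L[ℂ] (X i).H)
    (C₁ C₂ : (X j).H →L[ℂ] (X j).H) :
    ⟪vacuum X, vRep i A₁ (vRep j C₁ (vRep i B (vRep j C₂ (vRep i A₂ (vacuum X)))))⟫_ℂ =
      ⟪(X j).ξ, C₁ (X j).ξ⟫_ℂ * ⟪(X j).ξ, C₂ (X j).ξ⟫_ℂ * ⟪(X i).ξ, A₁ (B (A₂ (X i).ξ))⟫_ℂ +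
      ⟪(X i).ξ, A₁ (X i).ξ⟫_ℂ * ⟪(X i).ξ, B (X i).ξ⟫_ℂ * ⟪(X i).ξ, A₂ (X i).ξ⟫_ℂ *
        (⟪(X j).ξ, C₁ (C₂ (X j).ξ)⟫_ℂ - ⟪(X j).ξ, C₁ (X j).ξ⟫_ℂ * ⟪(X j).ξ, C₂ (X j).ξ⟫_ℂ) := by
  have hz : ∀ C : (X j).H →L[ℂ] (X j).H,
      ⟪(X j).ξ, C (X j).ξ - ⟪(X j).ξ, C (X j).ξ⟫_ℂ • (X j).ξ⟫_ℂ = 0 := fun C => by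
    rw [inner_sub_right, inner_smul_right, PointedHilbert.inner_ξ_ξ, mul_one, sub_self]
  have hU : ∀ f g, ⟪f, vRep i B g⟫_ℂ = ⟪projU i f, vRep i B (projU i g)⟫_ℂ := fun f g => by
    rw [vRep_projU, ← projU_vRep, ← adjoint_projU, ContinuousLinearMap.adjoint_inner_right,
      adjoint_projU, projU_vRep]
  have hs : ∀ {i : ι} (T : (X i).H →L[ℂ] (X i).H) (x y : (X i).H),
      ⟪star T x, y⟫_ℂ = ⟪x, T y⟫_ℂ := fun T x y => by
    rw [ContinuousLinearMap.star_eq_adjoint, ContinuousLinearMap.adjoint_inner_left]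
  have hs' : ∀ {i : ι} (T : (X i).H →L[ℂ] (X i).H) (x y : (X i).H),
      ⟪x, star T y⟫_ℂ = ⟪T x, y⟫_ℂ := fun T x y => by
    rw [ContinuousLinearMap.star_eq_adjoint, ContinuousLinearMap.adjoint_inner_right]
  have hc : ∀ (x : (X i).H) {y : (X j).H}, ⟪(X j).ξ, y⟫_ℂ = 0 →
      ⟪embed X i x, vRep i B (embed X j y)⟫_ℂ = 0 := fun x y hy => by
    rw [← inner_vRep_left, vRep_embed, inner_embed_embed h.ne _ hy]
  have hc' : ∀ {y : (X j).H} (x : (X i).H), ⟪(X j).ξ, y⟫_ℂ = 0 →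
      ⟪embed X j y, vRep i B (embed X i x)⟫_ℂ = 0 := fun x hy => by
    rw [vRep_embed, inner_eq_zero_symm, inner_embed_embed h.ne _ hy]
  rw [← inner_vRep_left, ← inner_vRep_left, vRep_apply_vacuum, vRep_apply_vacuum, hU,
    projU_vRep_embed h, projU_vRep_embed h]
  simp only [map_add, map_smul, inner_add_left, inner_add_right, inner_smul_left,
    inner_smul_right]
  rw [hc _ (hz _), hc' _ (hz _), inner_embed_vRep_embed h.ne', vRep_embed,
    LinearIsometry.inner_map_map, hs]
  simp only [inner_sub_left, inner_sub_right, inner_smul_left, inner_smul_right, inner_conj_symm,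
    hs, hs', PointedHilbert.inner_ξ_ξ]
  ring

end Moments

/-! ### Mixed moments in the V-monotone product of two states -/

namespace CStarProbSpace

section

variable (S T : CStarProbSpace.{u})

theorem vprod_state (x : (S.vprod T).A) :
    (S.vprod T).state x = ⟪vacuum _, vProductRep (pair S T) x (vacuum _)⟫_ℂ :=
  rfl

theorem vProductRep_inl (a : S.A) :
    vProductRep (pair S T) (inl a : (S.vprod T).A) =
      vRep (X := fun i => (pair S T i).pointed) 0 (S.gns.σ a) :=
  FreeProduct.lift_of (A := fun i => (pair S T i).A) _ 0 a

theorem vProductRep_inr (b : T.A) :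
    vProductRep (pair S T) (inr b : (S.vprod T).A) =
      vRep (X := fun i => (pair S T i).pointed) 1 (T.gns.σ b) :=
  FreeProduct.lift_of (A := fun i => (pair S T i).A) _ 1 b

theorem vProductRep_mul_apply (x y : (S.vprod T).A) (f) :
    vProductRep (pair S T) (x * y : (S.vprod T).A) f =
      vProductRep (pair S T) x (vProductRep (pair S T) y f) :=
  DFunLike.congr_fun (map_mul (vProductRep (pair S T)) x y) f

theorem gns_σ_mul_apply (a b : S.A) (x : S.gns.H) :
    S.gns.σ a (S.gns.σ b x) = S.gns.σ (a * b) x := by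
  rw [map_mul]
  rfl

variable {S T}

@[simp]
theorem state_inl (a : S.A) : (S.vprod T).state (inl a) = S.state a :=
  vProductState_of (pair S T) 0 a

@[simp]
theorem state_inr (b : T.A) : (S.vprod T).state (inr b) = T.state b :=
  vProductState_of (pair S T) 1 b

theorem state_inl_inr_inl (a a' : S.A) (b : T.A) :
    (S.vprod T).state (inl a * inr b * inl a') = S.state (a * a') * T.state b := by
  rw [vprod_state, vProductRep_mul_apply, vProductRep_mul_apply, vProductRep_inl, vProductRep_inl,
    vProductRep_inr, S.gns.state_eq, T.gns.state_eq, ← gns_σ_mul_apply]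
  exact inner_vacuum_vRep_three (X := fun i => (pair S T i).pointed) (i := 0) (j := 1)
    zero_ne_one _ _ _

theorem state_inr_inl_inr (b b' : T.A) (a : S.A) :
    (S.vprod T).state (inr b * inl a * inr b') = T.state (b * b') * S.state a := by
  rw [vprod_state, vProductRep_mul_apply, vProductRep_mul_apply, vProductRep_inr, vProductRep_inr,
    vProductRep_inl, S.gns.state_eq, T.gns.state_eq, ← gns_σ_mul_apply]
  exact inner_vacuum_vRep_three (X := fun i => (pair S T i).pointed) (i := 1) (j := 0)
    one_ne_zero _ _ _

theorem state_inl_inr_inl_inr_inl (a₁ b a₂ : S.A) (c₁ c₂ : T.A) :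
    (S.vprod T).state (inl a₁ * inr c₁ * inl b * inr c₂ * inl a₂) =
      T.state c₁ * T.state c₂ * S.state (a₁ * b * a₂) +
        S.state a₁ * S.state b * S.state a₂ *
          (T.state (c₁ * c₂) - T.state c₁ * T.state c₂) := by
  simp only [vprod_state, vProductRep_mul_apply, vProductRep_inr, vProductRep_inl,
    S.gns.state_eq, T.gns.state_eq, ← gns_σ_mul_apply]
  exact inner_vacuum_vRep_five (X := fun i => (pair S T i).pointed) (i := 0) (j := 1)
    zero_lt_one _ _ _ _ _

end

/-! ### A space with a non-multiplicative state -/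

/-- The algebra `ℂ ⊕ ℂ` of functions on a two-point space, with the uniform average as state. -/
noncomputable def fairCoin : CStarProbSpace.{u} where
  A := ULift.{u} Bool → ℂ
  state := (1 / 2 : ℂ) • (ContinuousLinearMap.proj ⟨true⟩ + ContinuousLinearMap.proj ⟨false⟩)
  state_nonneg a := by
    have h : ∀ z : ℂ, 0 ≤ star z * z := fun z => star_mul_self_nonneg z
    have h2 : (0 : ℂ) ≤ 1 / 2 := by norm_num [Complex.le_def]
    exact mul_nonneg h2 (add_nonneg (h _) (h _))
  norm_state := by
    set φ : (ULift.{u} Bool → ℂ) →L[ℂ] ℂ :=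
      (1 / 2 : ℂ) • (ContinuousLinearMap.proj ⟨true⟩ + ContinuousLinearMap.proj ⟨false⟩)
    refine le_antisymm (ContinuousLinearMap.opNorm_le_bound _ zero_le_one fun a => ?_) ?_
    · change ‖(1 / 2 : ℂ) * (a ⟨true⟩ + a ⟨false⟩)‖ ≤ 1 * ‖a‖
      rw [norm_mul]
      have h1 := norm_le_pi_norm a ⟨true⟩
      have h2 := norm_le_pi_norm a ⟨false⟩
      have h3 := norm_add_le (a ⟨true⟩) (a ⟨false⟩)
      have h4 : ‖(1 / 2 : ℂ)‖ = 1 / 2 := by norm_num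
      rw [h4]
      linarith
    · have h1 : φ 1 = 1 := by
        change (1 / 2 : ℂ) * (1 + 1) = 1
        norm_num
      have h2 := φ.le_opNorm 1
      rwa [h1, norm_one, norm_one, mul_one] at h2

theorem fairCoin_isUnital : fairCoin.{u}.IsUnital :=
  ⟨(1 : ULift.{u} Bool → ℂ), fun a => ⟨one_mul (M := ULift.{u} Bool → ℂ) a,
    mul_one (M := ULift.{u} Bool → ℂ) a⟩⟩

/-- The indicator function of one of the two points: a projection with expectation `1 / 2`. -/
def head : fairCoin.{u}.A := fun x : ULift.{u} Bool => if x.down then (1 : ℂ) else 0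

theorem head_mul_head : head.{u} * head = head := by
  refine funext fun x : ULift.{u} Bool => ?_
  change (if x.down then (1 : ℂ) else 0) * (if x.down then (1 : ℂ) else 0) =
    if x.down then (1 : ℂ) else 0
  split_ifs <;> simp

theorem state_head : fairCoin.{u}.state head = 1 / 2 := by
  change (1 / 2 : ℂ) * ((1 : ℂ) + 0) = 1 / 2
  norm_num

end CStarProbSpace

end VMonotone

/-! ### Non-associativity -/

theorem mainTheorem4 :
    (∀ (S₁ S₂ S₃ : CStarProbSpace.{u}) (a₁ a₂ : S₁.A) (b : S₂.A) (c₁ c₂ : S₃.A),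
      ((S₁.vprod S₂).vprod S₃).state
          (inl (inl a₁) * inr c₁ * inl (inr b) * inr c₂ * inl (inl a₂)) =
        S₁.state (a₁ * a₂) * S₂.state b * S₃.state c₁ * S₃.state c₂
          + S₁.state a₁ * S₁.state a₂ * S₂.state b * S₃.state (c₁ * c₂)
          - S₁.state a₁ * S₁.state a₂ * S₂.state b * S₃.state c₁ * S₃.state c₂ ∧
      (S₁.vprod (S₂.vprod S₃)).state
          (inl a₁ * inr (inr c₁) * inr (inl b) * inr (inr c₂) * inl a₂) =
        S₁.state (a₁ * a₂) * S₂.state b * S₃.state (c₁ * c₂)) ∧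
    ∃ S₁ S₂ S₃ : CStarProbSpace.{u}, S₁.IsUnital ∧ S₂.IsUnital ∧ S₃.IsUnital ∧
      (∃ (a₁ a₂ : S₁.A) (b : S₂.A) (c₁ c₂ : S₃.A),
        ((S₁.vprod S₂).vprod S₃).state
            (inl (inl a₁) * inr c₁ * inl (inr b) * inr c₂ * inl (inl a₂)) ≠
          (S₁.vprod (S₂.vprod S₃)).state
            (inl a₁ * inr (inr c₁) * inr (inl b) * inr (inr c₂) * inl a₂)) ∧
      ¬ ∀ x : ((S₁.vprod S₂).vprod S₃).A,
        (S₁.vprod (S₂.vprod S₃)).state (assoc S₁ S₂ S₃ x) =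
          ((S₁.vprod S₂).vprod S₃).state x := by
  have hL : ∀ (S₁ S₂ S₃ : CStarProbSpace.{u}) (a₁ a₂ : S₁.A) (b : S₂.A) (c₁ c₂ : S₃.A),
      ((S₁.vprod S₂).vprod S₃).state
          (inl (inl a₁) * inr c₁ * inl (inr b) * inr c₂ * inl (inl a₂)) =
        S₁.state (a₁ * a₂) * S₂.state b * S₃.state c₁ * S₃.state c₂
          + S₁.state a₁ * S₁.state a₂ * S₂.state b * S₃.state (c₁ * c₂)
          - S₁.state a₁ * S₁.state a₂ * S₂.state b * S₃.state c₁ * S₃.state c₂ := by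
    intro S₁ S₂ S₃ a₁ a₂ b c₁ c₂
    rw [state_inl_inr_inl_inr_inl, state_inl_inr_inl, state_inl, state_inl, state_inr]
    ring
  have hR : ∀ (S₁ S₂ S₃ : CStarProbSpace.{u}) (a₁ a₂ : S₁.A) (b : S₂.A) (c₁ c₂ : S₃.A),
      (S₁.vprod (S₂.vprod S₃)).state
          (inl a₁ * inr (inr c₁) * inr (inl b) * inr (inr c₂) * inl a₂) =
        S₁.state (a₁ * a₂) * S₂.state b * S₃.state (c₁ * c₂) := by
    intro S₁ S₂ S₃ a₁ a₂ b c₁ c₂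
    have h : (inl a₁ * inr (inr c₁) * inr (inl b) * inr (inr c₂) * inl a₂ :
        (S₁.vprod (S₂.vprod S₃)).A) = inl a₁ * inr (inr c₁ * inl b * inr c₂) * inl a₂ := by
      simp only [map_mul, mul_assoc]
    rw [h, state_inl_inr_inl, state_inr_inl_inr]
    ring
  refine ⟨fun S₁ S₂ S₃ a₁ a₂ b c₁ c₂ => ⟨hL S₁ S₂ S₃ a₁ a₂ b c₁ c₂, hR S₁ S₂ S₃ a₁ a₂ b c₁ c₂⟩,
    fairCoin, fairCoin, fairCoin, fairCoin_isUnital, fairCoin_isUnital, fairCoin_isUnital, ?_⟩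
  -- The moments are `3 / 32` and `1 / 8`.
  have hne : ((fairCoin.{u}.vprod fairCoin.{u}).vprod fairCoin.{u}).state
      (inl (inl head) * inr head * inl (inr head) * inr head * inl (inl head)) ≠
      (fairCoin.{u}.vprod (fairCoin.{u}.vprod fairCoin.{u})).state
        (inl head * inr (inr head) * inr (inl head) * inr (inr head) * inl head) := by
    rw [hL, hR, head_mul_head, state_head]
    norm_num
  refine ⟨⟨head, head, head, head, head, hne⟩, fun h => hne ?_⟩
  rw [← h]
  simp only [map_mul, assoc_inl_inl, assoc_inl_inr, assoc_inr]
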